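/- **Setting.** There are $N$ ads and $K$ displayed slots, $2\le K<N$. An allocation $\theta$ is a bijection $\pi(\cdot;\theta)$ from the ads to the slots $1,\dots,N$; only slots $1,\dots,K$ are displayed. Ad $i$ has a known quality $q_i\in(0,1]$ and a private value $v_i\in[0,V]$ per click, $V>0$. In the position-dependent cascade model with prominences $\lambda=(\lambda_1,\dots,\lambda_K)\in(0,1)^K$, the user of a round observes slot $1$, goes on from an observed slot $l$ to slot $l+1$ with probability $\lambda_l$, and clicks an observed ad $i$ with probability $q_i$, all independently and independently across rounds. So slot $m\le K$ is observed with probability $\Lambda_m=\prod_{l<m}\lambda_l$, and $\Lambda_m=0$ for $m>K$. With $\mathrm{SW}(\theta,v)=\sum_i\Lambda_{\pi(i;\theta)}q_iv_i$, the VCG payments are $p_i^*(v)=\mathrm{SW}(\theta^*_{-i},v_{-i})-\mathrm{SW}_{-i}(\theta^*,v)$, where $\theta^*$ is an efficient allocation, $\theta^*_{-i}$ is efficient when ad $i$ is absent, and $\mathrm{SW}_{-i}$ omits the term of $i$. An *online learning mechanism* over $T$ rounds (possibly randomized, with a random seed) chooses in each round $t$ an allocation $\theta_t$ from the seed, the reports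 in $[0,V]$ of rounds $\le t$, and the clicks observed on displayed ads in rounds $<t$. It then charges each advertiser $i$ a payment $p_{i,t}$ that may depend in addition on the clicks observed in round $t$; payments are integrable in the seed. It does not know $\lambda$. It is *DSIC a posteriori* if, for every seed, every click realization $(\mathrm{click}^i_m(t))\in\{0,1\}^{N\times K\times T}$, every advertiser $i$, every value $v_i$, and all sequences of reports of the other advertisers, reporting $v_i$ in every round maximizes the cumulative utility $\sum_t\big(v_i\,\mathrm{click}^i_{\pi(i;\theta_t)}(t)-p_{i,t}\big)$ over all sequences of own reports (an undisplayed ad gets no click). It is *IR in expectation* (resp. *WBB in expectation*) if, for every $\lambda\in(0,1)^K$ and $v\in[0,V]^N$, when all advertisers report $v$ truthfully, each advertiser's expected cumulative utility (resp. the expected total payment $\sum_{t,i}p_{i,t}$) is non-negative. Its expected revenue regret is $$R_T(\lambda,v)=T\sum_{i=1}^N p_i^*(v)-\mathbb E\Big[\sum_{t=1}^T\sum_{i=1}^N p_{i,t}\Big],$$ the expectation being over clicks and seed, under truthful reports $v$. **Theorem.** With the prominences unknown, every online learning mechanism that is DSIC a posteriori has worst-case expected regret $R_T=\Theta(T)$.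 Precisely, for all $N$, $K$, $V$, $q$ as above there are constants $c,C>0$, depending only on these, such that for every $T$ and every online learning mechanism over $T$ rounds that is DSIC a posteriori and IR in expectation: 1. there are $\lambda\in(0,1)^K$ and $v\in[0,V]^N$ with $R_T(\lambda,v)\ge c\,T$; 2. if the mechanism is also WBB in expectation, then $R_T(\lambda,v)\le C\,T$ for all $\lambda\in(0,1)^K$ and $v\in[0,V]^N$. -/

import Mathlib

open MeasureTheory

noncomputable section

namespace SponsoredSearch

/-- An allocation of the `N` ads to the slots `0, …, N - 1`: a bijection, `θ i` being the slot of
ad `i`.  Only the first `K` slots are displayed. -/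
abbrev Allocation (N : ℕ) := Equiv.Perm (Fin N)

/-- The interval `[0, V]` of admissible values and reports. -/
abbrev Value (V : ℝ) := Set.Icc (0 : ℝ) V

/-! ### The position-dependent cascade model and the VCG benchmark -/

/-- Cumulative observation probability `Λ_m` of slot `m` (slots are counted from `0`): the product
of the prominences of the slots above `m` if `m` is displayed, and `0` otherwise. -/
def cumProminence {K : ℕ} (lam : Fin K → ℝ) (m : ℕ) : ℝ :=
  if m < K then ∏ l ∈ Finset.univ.filter (fun l : Fin K => (l : ℕ) < m), lam l else 0

/-- Expected social welfare `SW(θ, v) = ∑ i, Λ_{π(i;θ)} q_i v_i`. -/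
def socialWelfare {N K : ℕ} (lam : Fin K → ℝ) (q : Fin N → ℝ) (θ : Allocation N)
    (v : Fin N → ℝ) : ℝ :=
  ∑ i, cumProminence lam (θ i) * q i * v i

/-- Social welfare of all the ads except ad `i`. -/
def socialWelfareWithout {N K : ℕ} (lam : Fin K → ℝ) (q : Fin N → ℝ) (i : Fin N)
    (θ : Allocation N) (v : Fin N → ℝ) : ℝ :=
  ∑ j ∈ Finset.univ.erase i, cumProminence lam (θ j) * q j * v j

/-- An efficient allocation `θ*`, i.e. a maximizer of the social welfare. -/
def efficientAllocation {N K : ℕ} (lam : Fin K → ℝ) (q : Fin N → ℝ) (v : Fin N → ℝ) :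
    Allocation N :=
  Classical.choose (Finite.exists_max (fun θ : Allocation N => socialWelfare lam q θ v))

/-- The allocation `θ*_{-i}` that is efficient when ad `i` is not present.  (The slot given to `i`
counts for nothing; as `Λ` is non-increasing and `K < N`, a maximizer can be taken with `i` in the
last, undisplayed, slot.) -/
def efficientAllocationWithout {N K : ℕ} (lam : Fin K → ℝ) (q : Fin N → ℝ) (i : Fin N)
    (v : Fin N → ℝ) : Allocation N :=
  Classical.choose
    (Finite.exists_max (fun θ : Allocation N => socialWelfareWithout lam q i θ v))

/-- VCG payment `p*_i(v) = SW(θ*_{-i}, v_{-i}) - SW_{-i}(θ*, v)`. -/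
def vcgPayment {N K : ℕ} (lam : Fin K → ℝ) (q : Fin N → ℝ) (v : Fin N → ℝ) (i : Fin N) : ℝ :=
  socialWelfareWithout lam q i (efficientAllocationWithout lam q i v) v
    - socialWelfareWithout lam q i (efficientAllocation lam q v) v

/-! ### Clicks -/

/-- A click realization of one round: `w i m` says whether ad `i` is clicked if it is displayed in
slot `m`. -/
abbrev ClickTable (N K : ℕ) := Fin N → Fin K → Bool

/-- The clicks that actually take place under allocation `θ`: an ad that is not displayed is not
clicked. -/
def clicked {N K : ℕ} (θ : Allocation N) (w : ClickTable N K) (i : Fin N) : Bool :=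
  if h : (θ i : ℕ) < K then w i ⟨θ i, h⟩ else false

/-- Behaviour of the user of one round.  `u.1 l`: having observed slot `l`, the user goes on to the
next slot.  `u.2 i m`: the user clicks ad `i` if she observes it in slot `m`. -/
abbrev UserBehaviour (N K : ℕ) := (Fin K → Bool) × (Fin N → Fin K → Bool)

/-- The click realization caused by a user: ad `i` in slot `m` is clicked iff slot `m` is reached
and the user clicks the ad when she observes it. -/
def UserBehaviour.clicks {N K : ℕ} (u : UserBehaviour N K) : ClickTable N K :=
  fun i m => decide ((∀ l, l < m → u.1 l = true) ∧ u.2 i m = true)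

/-- Probability of outcome `b` of a Bernoulli trial with parameter `p`. -/
def bernoulliWeight (p : ℝ) (b : Bool) : ℝ := if b then p else 1 - p

/-- Probability of a user behaviour: all its components are independent, `u.1 l` has parameter
`lam l` and `u.2 i m` has parameter `q i`. -/
def userProb {N K : ℕ} (lam : Fin K → ℝ) (q : Fin N → ℝ) (u : UserBehaviour N K) : ℝ :=
  (∏ l, bernoulliWeight (lam l) (u.1 l)) * ∏ i, ∏ m, bernoulliWeight (q i) (u.2 i m)

/-- Expectation over the clicks of `T` rounds, the users of different rounds being independent. -/
def clickExpectation {N K T : ℕ} (lam : Fin K → ℝ) (q : Fin N → ℝ)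
    (F : (Fin T → ClickTable N K) → ℝ) : ℝ :=
  ∑ u : Fin T → UserBehaviour N K,
    (∏ t, userProb lam q (u t)) * F (fun t => (u t).clicks)

/-! ### Online learning mechanisms -/

/-- A (possibly randomized) online mechanism for `N` ads with values in `[0, V]` and `T` rounds; `S`
with law `μ` is the random component.  The allocation of round `t` is a function of the seed, of the
reports of the rounds up to `t`, and of the clicks observed in the rounds before `t`; the payments
of round `t` may depend in addition on the clicks observed in round `t`.  The prominences are not an
input. -/
structure OnlineMechanism (N T : ℕ) (V : ℝ) {S : Type*} [MeasurableSpace S] (μ : Measure S) where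
  /-- the allocation rule -/
  alloc : S → (t : Fin T) → ({s : Fin T // s ≤ t} → Fin N → Value V) →
    ({s : Fin T // s < t} → Fin N → Bool) → Allocation N
  /-- the payment rule -/
  pay : S → (t : Fin T) → ({s : Fin T // s ≤ t} → Fin N → Value V) →
    ({s : Fin T // s ≤ t} → Fin N → Bool) → Fin N → ℝ
  measurable_alloc : ∀ t r o θ, MeasurableSet {σ | alloc σ t r o = θ}
  integrable_pay : ∀ t r o i, Integrable (fun σ => pay σ t r o i) μ

namespace OnlineMechanism

variable {N K T : ℕ} {V : ℝ} {S : Type*} [MeasurableSpace S] {μ : Measure S}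

/-- The allocation `θ_t` chosen in round `t` when the seed is `σ`, the reports are `r` and the click
realization is `ω`. -/
def run (M : OnlineMechanism N T V μ) (σ : S) (r : Fin T → Fin N → Value V)
    (ω : Fin T → ClickTable N K) (t : Fin T) : Allocation N :=
  M.alloc σ t (fun s => r s.1)
    (fun s => have : s.1 < t := s.2; clicked (M.run σ r ω s.1) (ω s.1))
termination_by t

/-- Whether ad `i` is clicked in round `t`. -/
def click (M : OnlineMechanism N T V μ) (σ : S) (r : Fin T → Fin N → Value V)
    (ω : Fin T → ClickTable N K) (t : Fin T) (i : Fin N) : Bool :=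
  clicked (M.run σ r ω t) (ω t) i

/-- The payment of advertiser `i` in round `t`. -/
def payment (M : OnlineMechanism N T V μ) (σ : S) (r : Fin T → Fin N → Value V)
    (ω : Fin T → ClickTable N K) (t : Fin T) (i : Fin N) : ℝ :=
  M.pay σ t (fun s => r s.1) (fun s => M.click σ r ω s.1) i

/-- Cumulative utility over the `T` rounds of advertiser `i`, whose true value is `v`. -/
def utility (M : OnlineMechanism N T V μ) (σ : S) (r : Fin T → Fin N → Value V)
    (ω : Fin T → ClickTable N K) (i : Fin N) (v : Value V) : ℝ :=
  ∑ t, ((if M.click σ r ω t i then (v : ℝ) else 0) - M.payment σ r ω t i)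

/-- DSIC a posteriori: for every realization of the random component and of all the clicks, for all
reports of the other advertisers and every sequence of own reports, advertiser `i` of value `v` is
at least as well off if it reports `v` in all the rounds. -/
def IsDSIC (M : OnlineMechanism N T V μ) (K : ℕ) : Prop :=
  ∀ (σ : S) (ω : Fin T → ClickTable N K) (i : Fin N) (v : Value V) (r : Fin T → Fin N → Value V),
    M.utility σ r ω i v ≤ M.utility σ (fun t => Function.update (r t) i v) ω i v

/-- Expectation over the random component of the mechanism and over the clicks. -/
def expectation (μ : Measure S) (lam : Fin K → ℝ) (q : Fin N → ℝ)
    (F : S → (Fin T → ClickTable N K) → ℝ) : ℝ :=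
  ∫ σ, clickExpectation lam q (F σ) ∂μ

/-- Individual rationality in expectation: under truthful reports no advertiser has a negative
expected utility, whatever the prominences. -/
def IsIR (M : OnlineMechanism N T V μ) (K : ℕ) (q : Fin N → ℝ) : Prop :=
  ∀ (lam : Fin K → ℝ), (∀ l, 0 < lam l ∧ lam l < 1) → ∀ (v : Fin N → Value V) (i : Fin N),
    0 ≤ expectation μ lam q (fun σ ω => M.utility σ (fun _ => v) ω i (v i))

/-- Expected total revenue of the auctioneer under truthful reports. -/
def expectedRevenue (M : OnlineMechanism N T V μ) (lam : Fin K → ℝ) (q : Fin N → ℝ)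
    (v : Fin N → Value V) : ℝ :=
  expectation μ lam q (fun σ ω => ∑ t, ∑ i, M.payment σ (fun _ => v) ω t i)

/-- Weak budget balance in expectation: under truthful reports the expected total revenue is not
negative, whatever the prominences. -/
def IsWBB (M : OnlineMechanism N T V μ) (K : ℕ) (q : Fin N → ℝ) : Prop :=
  ∀ (lam : Fin K → ℝ), (∀ l, 0 < lam l ∧ lam l < 1) → ∀ (v : Fin N → Value V),
    0 ≤ M.expectedRevenue lam q v

/-- Expected regret `R_T`: the revenue of `T` rounds of the VCG mechanism with the actual
parameters, minus the expected revenue of the mechanism. -/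
def regret (M : OnlineMechanism N T V μ) (lam : Fin K → ℝ) (q : Fin N → ℝ)
    (v : Fin N → Value V) : ℝ :=
  T * (∑ i, vcgPayment lam q (fun j => (v j : ℝ)) i) - M.expectedRevenue lam q v

end OnlineMechanism

end SponsoredSearch

end

/-!
The upper bound is immediate: the VCG payments of a round are at most `N * (N * V)`, and the revenue
of a weakly budget-balanced mechanism is non-negative.

The lower bound rests on a constraint that the *observability* of clicks puts on the slots of an ad.
Fix the seed, the reports of the others and the clicks before round `t`, and let ad `i` bid
constantly. By truthfulness its utility is a convex function of the bid with the number of clicks as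
subgradient. Let ad `i` receive no click after round `t`, and flip its click in a slot `m` in
round `t`. The utilities at two bids `a < b` at which `i` is not in slot `m` do not notice the flip,
whereas the slope in between goes up by one at each bid with `i` in slot `m`. So these bids are
kinks of one convex function, and as click counts lie in `[0, T]` there are at most `T + 1` of them
(`OnlineMechanism.IsDSIC.card_slot_le`): essentially, an ad that is out of the second slot at `a`
and at `b` is out of it in between.

Now let all prominences equal a small constant, measure the ads by their worth per observation
`q i * v i`, and suppose that the regret is small for all `v`. Truthfulness and individual
rationality leave the advertiser `i` a rent of at least `(v i - x)` times its clicks at the bid `x`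
(`OnlineMechanism.expectedRevenue_le`). So it gets few clicks at `x` whenever VCG extracts almost
the whole welfare at `v` (`OnlineMechanism.expectedClicks_update_le`). This has two consequences.

* All ads worth about `z`: VCG extracts almost everything, so an ad lowering its bid to `0` is
  hardly ever in the second slot (`OnlineMechanism.occupancy_second_of_bid_zero_le`).
* Two ads worth `2 z`, the others about `z`: VCG extracts almost everything since only the first
  slot matters much. So if one of the two lowers its bid to about `z`, it is hardly ever in the first
  slot. Hence the only ad worth `2 z` among ads worth about `z` is nearly always in the first slot
  and hardly ever in the second (`OnlineMechanism.occupancy_second_of_high_le`).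

By the constraint, no ad is in the second slot for a sizeable fraction of its bids near `z`, if the
others are worth about `z` too. Averaging over a fine grid of profiles near `(z, …, z)` contradicts
the fact that some ad is always in the second slot (`OnlineMechanism.exists_regret_gt`). The grid is
finite, so nothing is needed about the measurability of the mechanism in the reports.
-/

namespace SponsoredSearch

/-! ### Observation probabilities -/

section Prominence

variable {N K : ℕ}

lemma cumProminence_nonneg {lam : Fin K → ℝ} (h : ∀ l, 0 ≤ lam l) (m : ℕ) :
    0 ≤ cumProminence lam m := by
  unfold cumProminence
  split_ifs
  · exact Finset.prod_nonneg fun l _ => h l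
  · exact le_rfl

lemma cumProminence_le_one {lam : Fin K → ℝ} (h : ∀ l, 0 ≤ lam l ∧ lam l ≤ 1) (m : ℕ) :
    cumProminence lam m ≤ 1 := by
  unfold cumProminence
  split_ifs
  · exact Finset.prod_le_one (fun l _ => (h l).1) fun l _ => (h l).2
  · exact zero_le_one

lemma cumProminence_of_le {lam : Fin K → ℝ} {m : ℕ} (h : K ≤ m) : cumProminence lam m = 0 :=
  if_neg h.not_gt

lemma cumProminence_zero (hK : 0 < K) (lam : Fin K → ℝ) : cumProminence lam 0 = 1 := by
  simp [cumProminence, hK]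

lemma cumProminence_one (hK : 1 < K) (lam : Fin K → ℝ) :
    cumProminence lam 1 = lam ⟨0, by omega⟩ := by
  have : (Finset.univ.filter fun l : Fin K => (l : ℕ) < 1) = {⟨0, by omega⟩} := by
    ext l
    simp [Fin.ext_iff]
  rw [cumProminence, if_pos hK, this, Finset.prod_singleton]

lemma cumProminence_le_first (hK : 0 < K) {lam : Fin K → ℝ} (h : ∀ l, 0 ≤ lam l ∧ lam l ≤ 1)
    {m : ℕ} (hm : m ≠ 0) : cumProminence lam m ≤ lam ⟨0, hK⟩ := by
  unfold cumProminence
  split_ifs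
  · rw [← Finset.mul_prod_erase _ lam
      (show (⟨0, hK⟩ : Fin K) ∈ Finset.univ.filter (fun l : Fin K => (l : ℕ) < m) by
        simp; omega)]
    exact mul_le_of_le_one_right (h _).1
      (Finset.prod_le_one (fun l _ => (h l).1) fun l _ => (h l).2)
  · exact (h _).1

/-- The total observation probability of all the slots, whatever the ads displayed there. -/
lemma sum_cumProminence_perm (lam : Fin K → ℝ) (θ : Allocation N) :
    ∑ i, cumProminence lam (θ i) = ∑ m : Fin N, cumProminence lam m :=
  Equiv.sum_comp θ fun m : Fin N => cumProminence lam m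

/-- Only the first slot is observed with a probability above the first prominence. -/
lemma sum_cumProminence_le (hK : 0 < K) {lam : Fin K → ℝ} (h : ∀ l, 0 ≤ lam l ∧ lam l ≤ 1) :
    ∑ m : Fin N, cumProminence lam m ≤ 1 + N * lam ⟨0, hK⟩ := by
  calc ∑ m : Fin N, cumProminence lam m
      ≤ ∑ m : Fin N, ((if (m : ℕ) = 0 then 1 else 0) + lam ⟨0, hK⟩) := by
        refine Finset.sum_le_sum fun m _ => ?_
        split_ifs with hm
        · linarith [cumProminence_le_one h m, (h ⟨0, hK⟩).1]
        · linarith [cumProminence_le_first hK h hm]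
    _ ≤ 1 + N * lam ⟨0, hK⟩ := by
        rw [Finset.sum_add_distrib]
        simp only [Finset.sum_const, Finset.card_univ, Fintype.card_fin, nsmul_eq_mul]
        gcongr
        rw [Finset.sum_boole]
        norm_cast
        refine Finset.card_le_one.2 fun a ha b hb => ?_
        simp only [Finset.mem_filter, Finset.mem_univ, true_and] at ha hb
        exact Fin.ext (ha.trans hb.symm)

lemma socialWelfare_le {lam : Fin K → ℝ} (h : ∀ l, 0 ≤ lam l) {q v : Fin N → ℝ} {b : ℝ}
    (hb : ∀ i, q i * v i ≤ b) (θ : Allocation N) :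
    socialWelfare lam q θ v ≤ b * ∑ m : Fin N, cumProminence lam m := by
  rw [← sum_cumProminence_perm lam θ, Finset.mul_sum]
  refine Finset.sum_le_sum fun i _ => ?_
  rw [mul_assoc, mul_comm b]
  exact mul_le_mul_of_nonneg_left (hb i) (cumProminence_nonneg h _)

end Prominence

/-! ### Bounds for the VCG payments -/

section VCG

variable {N K : ℕ} (lam : Fin K → ℝ) (q v : Fin N → ℝ)

lemma socialWelfareWithout_le_efficient (i : Fin N) (θ : Allocation N) :
    socialWelfareWithout lam q i θ v
      ≤ socialWelfareWithout lam q i (efficientAllocationWithout lam q i v) v :=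
  Classical.choose_spec
    (Finite.exists_max fun θ : Allocation N => socialWelfareWithout lam q i θ v) θ

lemma vcgPayment_nonneg (i : Fin N) : 0 ≤ vcgPayment lam q v i :=
  sub_nonneg.2 (socialWelfareWithout_le_efficient lam q v i _)

/-- The externality of ad `i` is at least what ad `j` would gain from taking over its slot. -/
lemma le_vcgPayment_swap {i j : Fin N} (hij : i ≠ j) :
    (cumProminence lam (efficientAllocation lam q v i)
      - cumProminence lam (efficientAllocation lam q v j)) * (q j * v j)
        ≤ vcgPayment lam q v i := by
  set θ := efficientAllocation lam q v with hθ
  have h := socialWelfareWithout_le_efficient lam q v i ((Equiv.swap i j).trans θ)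
  have hj : j ∈ Finset.univ.erase i := by simp [hij.symm]
  unfold vcgPayment
  rw [← hθ]
  suffices socialWelfareWithout lam q i ((Equiv.swap i j).trans θ) v
      = socialWelfareWithout lam q i θ v
        + (cumProminence lam (θ i) - cumProminence lam (θ j)) * (q j * v j) by linarith
  unfold socialWelfareWithout
  rw [← Finset.add_sum_erase _ _ hj, ← Finset.add_sum_erase _ _ hj]
  have : ∀ k ∈ (Finset.univ.erase i).erase j,
      cumProminence lam (((Equiv.swap i j).trans θ) k) * q k * v k
        = cumProminence lam (θ k) * q k * v k := by
    intro k hk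
    simp only [Finset.mem_erase, Finset.mem_univ, and_true] at hk
    simp [Equiv.swap_apply_of_ne_of_ne hk.2 hk.1]
  rw [Finset.sum_congr rfl this]
  simp only [Equiv.trans_apply, Equiv.swap_apply_right]
  ring

/-- If every ad is worth at least `z` per observation, each displayed ad keeps an undisplayed one
of that worth out of its slot. -/
lemma le_sum_vcgPayment (hKN : K < N) {lam : Fin K → ℝ} (h : ∀ l, 0 ≤ lam l) {z : ℝ}
    (hz : ∀ i, z ≤ q i * v i) :
    z * ∑ m : Fin N, cumProminence lam m ≤ ∑ i, vcgPayment lam q v i := by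
  rw [← sum_cumProminence_perm lam (efficientAllocation lam q v), Finset.mul_sum]
  refine Finset.sum_le_sum fun i _ => ?_
  set θ := efficientAllocation lam q v with hθ
  by_cases hi : K ≤ (θ i : ℕ)
  · rw [cumProminence_of_le hi, mul_zero]
    exact vcgPayment_nonneg lam q v i
  · set j := θ.symm ⟨K, hKN⟩ with hj
    have hθj : (θ j : ℕ) = K := by simp [hj]
    have hij : i ≠ j := by
      rintro rfl
      exact hi hθj.ge
    have := le_vcgPayment_swap lam q v hij
    rw [← hθ, cumProminence_of_le hθj.ge, sub_zero] at this
    refine le_trans ?_ this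
    rw [mul_comm]
    exact mul_le_mul_of_nonneg_left (hz j) (cumProminence_nonneg h _)

/-- If two ads are worth `b` per observation, one of them is kept out of the first slot. -/
lemma le_sum_vcgPayment_of_pair (hK : 0 < K) (hKN : K < N) {lam : Fin K → ℝ}
    (h : ∀ l, 0 ≤ lam l ∧ lam l ≤ 1) {b : ℝ} {i j : Fin N} (hij : i ≠ j)
    (hi : q i * v i = b) (hj : q j * v j = b) (hb : 0 ≤ b) :
    (1 - lam ⟨0, hK⟩) * b ≤ ∑ i, vcgPayment lam q v i := by
  set θ := efficientAllocation lam q v with hθ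
  set k := θ.symm ⟨0, by omega⟩ with hk
  have hθk : (θ k : ℕ) = 0 := by simp [hk]
  obtain ⟨l, hl, hlb⟩ : ∃ l, k ≠ l ∧ q l * v l = b := by
    by_cases hki : k = i
    · exact ⟨j, hki ▸ hij, hj⟩
    · exact ⟨i, hki, hi⟩
  have hθl : (θ l : ℕ) ≠ 0 := fun h0 => hl (θ.injective (Fin.ext (hθk.trans h0.symm)))
  have := le_vcgPayment_swap lam q v hl
  rw [← hθ, hθk, cumProminence_zero hK, hlb] at this
  calc _ ≤ (1 - cumProminence lam (θ l)) * b := by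
        gcongr
        exact cumProminence_le_first hK h hθl
    _ ≤ vcgPayment lam q v k := this
    _ ≤ _ := Finset.single_le_sum (fun i _ => vcgPayment_nonneg lam q v i) (Finset.mem_univ k)

lemma vcgPayment_le {lam : Fin K → ℝ} (h : ∀ l, 0 ≤ lam l ∧ lam l ≤ 1) {V : ℝ}
    (hw : ∀ i, 0 ≤ q i * v i ∧ q i * v i ≤ V) (i : Fin N) : vcgPayment lam q v i ≤ N * V := by
  have h0 : ∀ θ : Allocation N, ∀ j, 0 ≤ cumProminence lam (θ j) * q j * v j := fun θ j => by
    rw [mul_assoc]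
    exact mul_nonneg (cumProminence_nonneg (fun l => (h l).1) _) (hw j).1
  have h1 : 0 ≤ socialWelfareWithout lam q i (efficientAllocation lam q v) v :=
    Finset.sum_nonneg fun j _ => h0 _ j
  have h2 : socialWelfareWithout lam q i (efficientAllocationWithout lam q i v) v ≤ N * V := by
    calc _ ≤ ∑ j : Fin N, cumProminence lam (efficientAllocationWithout lam q i v j) * q j * v j :=
          Finset.sum_le_sum_of_subset_of_nonneg (Finset.erase_subset _ _) fun j _ _ => h0 _ j
      _ ≤ ∑ _j : Fin N, V := by
          refine Finset.sum_le_sum fun j _ => ?_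
          rw [mul_assoc]
          exact (mul_le_of_le_one_left (hw j).1 (cumProminence_le_one h _)).trans (hw j).2
      _ = N * V := by simp
  unfold vcgPayment
  linarith

end VCG

/-! ### Expectations over the clicks -/

section Clicks

/-- Exchanging the `t`-th coordinate of `u` with `y`, over all pairs `(u, y)`. -/
lemma sum_sum_update_swap {ι X R : Type*} [Fintype ι] [DecidableEq ι] [Fintype X]
    [AddCommMonoid R] (t : ι) (F : (ι → X) → X → R) :
    ∑ u : ι → X, ∑ y, F (Function.update u t y) (u t) = ∑ u : ι → X, ∑ y, F u y := by
  classical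
  rw [← Fintype.sum_prod_type', ← Fintype.sum_prod_type']
  let e : (ι → X) × X ≃ (ι → X) × X :=
    { toFun := fun p => (Function.update p.1 t p.2, p.1 t)
      invFun := fun p => (Function.update p.1 t p.2, p.1 t)
      left_inv := fun p => by simp
      right_inv := fun p => by simp }
  exact Equiv.sum_comp e fun p : (ι → X) × X => F p.1 p.2

variable {N K T : ℕ} {lam : Fin K → ℝ} {q : Fin N → ℝ}

lemma bernoulliWeight_nonneg {p : ℝ} (h : 0 ≤ p ∧ p ≤ 1) (b : Bool) :
    0 ≤ bernoulliWeight p b := by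
  unfold bernoulliWeight
  split_ifs <;> linarith [h.1, h.2]

lemma userProb_nonneg (hl : ∀ l, 0 ≤ lam l ∧ lam l ≤ 1) (hq : ∀ i, 0 ≤ q i ∧ q i ≤ 1)
    (u : UserBehaviour N K) : 0 ≤ userProb lam q u :=
  mul_nonneg (Finset.prod_nonneg fun l _ => bernoulliWeight_nonneg (hl l) _)
    (Finset.prod_nonneg fun i _ => Finset.prod_nonneg fun _ _ => bernoulliWeight_nonneg (hq i) _)

/-- A product event about a user has as probability the product of the probabilities of its
factors. -/
lemma sum_userProb_mul (f : Fin K → Bool → ℝ) (g : Fin N → Fin K → Bool → ℝ) :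
    ∑ u : UserBehaviour N K, userProb lam q u * ((∏ l, f l (u.1 l)) * ∏ i, ∏ m, g i m (u.2 i m))
      = (∏ l, ∑ b, bernoulliWeight (lam l) b * f l b)
        * ∏ i, ∏ m, ∑ b, bernoulliWeight (q i) b * g i m b := by
  simp_rw [Finset.prod_univ_sum, Fintype.piFinset_univ]
  rw [Fintype.sum_prod_type, Finset.sum_mul_sum]
  refine Finset.sum_congr rfl fun a _ => Finset.sum_congr rfl fun b _ => ?_
  simp only [userProb, Finset.prod_mul_distrib]
  ring

lemma sum_userProb (lam : Fin K → ℝ) (q : Fin N → ℝ) :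
    ∑ u : UserBehaviour N K, userProb lam q u = 1 := by
  have := sum_userProb_mul (lam := lam) (q := q) (fun _ _ => 1) (fun _ _ _ => 1)
  simpa [bernoulliWeight] using this

/-- An ad in slot `m` is clicked with probability `Λ_m q_i`. -/
lemma sum_userProb_clicked (θ : Allocation N) (i : Fin N) :
    ∑ u : UserBehaviour N K, userProb lam q u * (if clicked θ u.clicks i then 1 else 0)
      = q i * cumProminence lam (θ i) := by
  unfold clicked
  by_cases h : (θ i : ℕ) < K
  · simp only [dif_pos h]
    have key := sum_userProb_mul (lam := lam) (q := q)
      (fun l b => if l < (⟨θ i, h⟩ : Fin K) then (if b then 1 else 0) else 1)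
      (fun j m b => if j = i then if m = ⟨θ i, h⟩ then (if b then 1 else 0) else 1 else 1)
    refine (Finset.sum_congr rfl fun u _ => ?_).trans (key.trans ?_)
    · congr 1
      have h1 : (∏ l, if l < (⟨θ i, h⟩ : Fin K) then (if u.1 l then (1 : ℝ) else 0) else 1)
          = if ∀ l, l < (⟨θ i, h⟩ : Fin K) → u.1 l = true then 1 else 0 := by
        split_ifs with hh
        · refine Finset.prod_eq_one fun l _ => ?_
          by_cases hl : l < (⟨θ i, h⟩ : Fin K) <;> simp [hl, hh l]
        · push Not at hh
          obtain ⟨l, hl, hu⟩ := hh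
          exact Finset.prod_eq_zero (Finset.mem_univ l) (by simp [hl, hu])
      have h2 : (∏ j, ∏ m, if j = i then if m = (⟨θ i, h⟩ : Fin K) then
          (if u.2 j m then (1 : ℝ) else 0) else 1 else 1)
          = if u.2 i ⟨θ i, h⟩ = true then 1 else 0 := by
        rw [Finset.prod_eq_single i (fun j _ hj => by simp [hj]) (by simp),
          Finset.prod_eq_single ⟨θ i, h⟩ (fun m _ hm => by simp [hm]) (by simp)]
        simp
      rw [h1, h2]
      simp only [UserBehaviour.clicks, decide_eq_true_eq]
      split_ifs <;> simp_all
    · rw [mul_comm]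
      congr 1
      · rw [Finset.prod_eq_single i (fun j _ hj => by simp [hj, bernoulliWeight]) (by simp),
          Finset.prod_eq_single ⟨θ i, h⟩
            (fun m _ hm => by simp [hm, bernoulliWeight]) (by simp)]
        simp [bernoulliWeight]
      · rw [cumProminence, if_pos h, Finset.prod_filter]
        refine Finset.prod_congr rfl fun l _ => ?_
        by_cases hl : (l : ℕ) < θ i <;> simp [hl, Fin.lt_def, bernoulliWeight]
  · simp [h, cumProminence_of_le (not_lt.1 h)]

lemma sum_prod_userProb (lam : Fin K → ℝ) (q : Fin N → ℝ) (T : ℕ) :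
    ∑ u : Fin T → UserBehaviour N K, ∏ t, userProb lam q (u t) = 1 := by
  have := Finset.prod_univ_sum (fun _ : Fin T => (Finset.univ : Finset (UserBehaviour N K)))
    fun _ u => userProb lam q u
  rw [Fintype.piFinset_univ] at this
  rw [← this]
  simp [sum_userProb]

/-- The user of round `t` is independent of the clicks of the other rounds: replacing her by a fresh
user changes no expectation. -/
lemma clickExpectation_resample (t : Fin T) (F : (Fin T → ClickTable N K) → ClickTable N K → ℝ)
    (hF : ∀ ω w, F (Function.update ω t w) = F ω) :
    clickExpectation lam q (fun ω => F ω (ω t))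
      = clickExpectation lam q fun ω => ∑ y, userProb lam q y * F ω y.clicks := by
  have hF' : ∀ (u : Fin T → UserBehaviour N K) y, F (fun s => (Function.update u t y s).clicks)
      = F fun s => (u s).clicks := by
    intro u y
    rw [← hF (fun s => (u s).clicks) y.clicks]
    congr 1
    funext s
    by_cases hs : s = t
    · subst hs; simp
    · simp [hs]
  have hW : ∀ (u : Fin T → UserBehaviour N K) y,
      (∏ s, userProb lam q (Function.update u t y s)) * userProb lam q (u t)
        = (∏ s, userProb lam q (u s)) * userProb lam q y := by
    intro u y
    rw [← Finset.mul_prod_erase _ _ (Finset.mem_univ t),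
      ← Finset.mul_prod_erase _ (fun s => userProb lam q (u s)) (Finset.mem_univ t)]
    have : ∀ s ∈ Finset.univ.erase t, userProb lam q (Function.update u t y s)
        = userProb lam q (u s) := fun s hs => by
      rw [Function.update_of_ne (Finset.ne_of_mem_erase hs)]
    rw [Finset.prod_congr rfl this]
    simp only [Function.update_self]
    ring
  unfold clickExpectation
  calc _ = ∑ u : Fin T → UserBehaviour N K, ∑ y, (∏ s, userProb lam q (u s)) * userProb lam q y
          * F (fun s => (u s).clicks) (u t).clicks := by
        refine Finset.sum_congr rfl fun u _ => ?_
        rw [← Finset.sum_mul, ← Finset.mul_sum, sum_userProb, mul_one]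
    _ = ∑ u : Fin T → UserBehaviour N K, ∑ y, (∏ s, userProb lam q (u s)) * userProb lam q y
          * F (fun s => (u s).clicks) y.clicks := by
        rw [← sum_sum_update_swap t]
        refine Finset.sum_congr rfl fun u _ => Finset.sum_congr rfl fun y _ => ?_
        rw [hF', hW, Function.update_self]
    _ = _ := by
        refine Finset.sum_congr rfl fun u _ => ?_
        rw [Finset.mul_sum]
        exact Finset.sum_congr rfl fun y _ => by ring

end Clicks

section Expectation

variable {N K T : ℕ} {lam : Fin K → ℝ} {q : Fin N → ℝ} {S : Type*} [MeasurableSpace S]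
  {μ : Measure S}

namespace OnlineMechanism

lemma integrable_clickExpectation {F : S → (Fin T → ClickTable N K) → ℝ}
    (hF : ∀ ω, Integrable (fun σ => F σ ω) μ) :
    Integrable (fun σ => clickExpectation lam q (F σ)) μ :=
  integrable_finsetSum _ fun _ _ => (hF _).const_mul _

lemma expectation_mono (hl : ∀ l, 0 ≤ lam l ∧ lam l ≤ 1) (hq : ∀ i, 0 ≤ q i ∧ q i ≤ 1)
    {F G : S → (Fin T → ClickTable N K) → ℝ}
    (hF : ∀ ω, Integrable (fun σ => F σ ω) μ) (hG : ∀ ω, Integrable (fun σ => G σ ω) μ)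
    (h : ∀ σ ω, F σ ω ≤ G σ ω) : expectation μ lam q F ≤ expectation μ lam q G :=
  integral_mono (integrable_clickExpectation hF) (integrable_clickExpectation hG) fun σ =>
    Finset.sum_le_sum fun u _ => mul_le_mul_of_nonneg_left (h σ _)
      (Finset.prod_nonneg fun t _ => userProb_nonneg hl hq (u t))

lemma expectation_add {F G : S → (Fin T → ClickTable N K) → ℝ}
    (hF : ∀ ω, Integrable (fun σ => F σ ω) μ) (hG : ∀ ω, Integrable (fun σ => G σ ω) μ) :
    expectation μ lam q (fun σ ω => F σ ω + G σ ω)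
      = expectation μ lam q F + expectation μ lam q G := by
  unfold expectation
  rw [← integral_add (integrable_clickExpectation hF) (integrable_clickExpectation hG)]
  simp only [clickExpectation, mul_add, Finset.sum_add_distrib]

lemma expectation_const_mul (c : ℝ) (F : S → (Fin T → ClickTable N K) → ℝ) :
    expectation μ lam q (fun σ ω => c * F σ ω) = c * expectation μ lam q F := by
  unfold expectation
  rw [← integral_const_mul]
  simp only [clickExpectation, Finset.mul_sum, mul_left_comm]

lemma expectation_sub {F G : S → (Fin T → ClickTable N K) → ℝ}
    (hF : ∀ ω, Integrable (fun σ => F σ ω) μ) (hG : ∀ ω, Integrable (fun σ => G σ ω) μ) :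
    expectation μ lam q (fun σ ω => F σ ω - G σ ω)
      = expectation μ lam q F - expectation μ lam q G := by
  unfold expectation
  rw [← integral_sub (integrable_clickExpectation hF) (integrable_clickExpectation hG)]
  simp only [clickExpectation, mul_sub, Finset.sum_sub_distrib]

lemma expectation_sum {ι : Type*} (s : Finset ι) {F : ι → S → (Fin T → ClickTable N K) → ℝ}
    (hF : ∀ i ∈ s, ∀ ω, Integrable (fun σ => F i σ ω) μ) :
    expectation μ lam q (fun σ ω => ∑ i ∈ s, F i σ ω)
      = ∑ i ∈ s, expectation μ lam q (F i) := by
  unfold expectation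
  rw [← integral_finsetSum _ fun i hi => integrable_clickExpectation (hF i hi)]
  simp only [clickExpectation, Finset.mul_sum]
  congr 1
  funext σ
  rw [Finset.sum_comm]

lemma expectation_const [IsProbabilityMeasure μ] (c : ℝ) :
    expectation μ lam q (fun _ (_ : Fin T → ClickTable N K) => c) = c := by
  simp [expectation, clickExpectation, ← Finset.sum_mul, sum_prod_userProb]

end OnlineMechanism

end Expectation

namespace OnlineMechanism

variable {N K T : ℕ} {V : ℝ} {S : Type*} [MeasurableSpace S] {μ : Measure S}

/-! ### Runs of a mechanism -/

/-- The run up to round `t` depends on the click realization only through the clicks which take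
place before round `t`. -/
lemma run_congr (M : OnlineMechanism N T V μ) (σ : S) (r : Fin T → Fin N → Value V)
    {ω ω' : Fin T → ClickTable N K} (t : Fin T)
    (h : ∀ s < t, clicked (M.run σ r ω s) (ω s) = clicked (M.run σ r ω s) (ω' s)) :
    M.run σ r ω t = M.run σ r ω' t := by
  induction t using WellFoundedLT.induction with
  | ind t ih =>
    rw [run, run]
    congr 1
    funext s
    rw [h s.1 s.2, ih s.1 s.2 fun s' hs' => h s' (hs'.trans s.2)]

lemma run_update (M : OnlineMechanism N T V μ) (σ : S) (r : Fin T → Fin N → Value V)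
    (ω : Fin T → ClickTable N K) (t : Fin T) (w : ClickTable N K) :
    M.run σ r (Function.update ω t w) t = M.run σ r ω t :=
  M.run_congr σ r t fun s hs => by rw [Function.update_of_ne hs.ne]

section Measurability

variable (M : OnlineMechanism N T V μ) (r : Fin T → Fin N → Value V) (ω : Fin T → ClickTable N K)

/-- A mechanism that observes finitely many data chooses measurably in the seed. -/
lemma measurableSet_run (t : Fin T) (θ : Allocation N) :
    MeasurableSet {σ | M.run σ r ω t = θ} := by
  induction t using WellFoundedLT.induction generalizing θ with
  | ind t ih =>
    have : {σ | M.run σ r ω t = θ} = ⋃ f : {s : Fin T // s < t} → Allocation N,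
        (⋂ s, {σ | M.run σ r ω s.1 = f s}) ∩
          {σ | M.alloc σ t (fun s => r s.1) (fun s => clicked (f s) (ω s.1)) = θ} := by
      ext σ
      simp only [Set.mem_ofPred_eq, Set.mem_iUnion, Set.mem_inter_iff, Set.mem_iInter]
      rw [run]
      constructor
      · intro h
        exact ⟨fun s => M.run σ r ω s.1, fun _ => rfl, h⟩
      · rintro ⟨f, hf, h⟩
        simpa only [hf] using h
    rw [this]
    exact MeasurableSet.iUnion fun f =>
      (MeasurableSet.iInter fun s : {s : Fin T // s < t} => ih s.1 s.2 _).inter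
        (M.measurable_alloc _ _ _ _)

lemma integrable_of_run [IsFiniteMeasure μ] (t : Fin T) (f : Allocation N → ℝ) :
    Integrable (fun σ => f (M.run σ r ω t)) μ := by
  have : (fun σ => f (M.run σ r ω t))
      = fun σ => ∑ θ, Set.indicator {σ | M.run σ r ω t = θ} (fun _ => f θ) σ := by
    funext σ
    rw [Finset.sum_eq_single (M.run σ r ω t) (fun θ _ hθ => by simp [hθ.symm]) (by simp)]
    simp
  rw [this]
  exact integrable_finsetSum _ fun θ _ =>
    (integrable_const _).indicator (M.measurableSet_run r ω t θ)

lemma integrable_payment (t : Fin T) (i : Fin N) :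
    Integrable (fun σ => M.payment σ r ω t i) μ := by
  have : (fun σ => M.payment σ r ω t i)
      = fun σ => ∑ f : {s : Fin T // s ≤ t} → Allocation N,
        Set.indicator (⋂ s, {σ | M.run σ r ω s.1 = f s})
          (fun σ => M.pay σ t (fun s => r s.1) (fun s => clicked (f s) (ω s.1)) i) σ := by
    funext σ
    rw [Finset.sum_eq_single (fun s : {s : Fin T // s ≤ t} => M.run σ r ω s.1) _ (by simp)]
    · rw [Set.indicator_of_mem (by simp)]
      rfl
    · intro f _ hf
      refine Set.indicator_of_notMem (fun h => hf ?_) _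
      simp only [Set.mem_iInter, Set.mem_ofPred_eq] at h
      exact funext fun s => (h s).symm
  rw [this]
  exact integrable_finsetSum _ fun f _ =>
    (M.integrable_pay _ _ _ _).indicator (MeasurableSet.iInter fun s => M.measurableSet_run r ω _ _)

lemma integrable_totalPayment (i : Fin N) :
    Integrable (fun σ => ∑ t, M.payment σ r ω t i) μ :=
  integrable_finsetSum _ fun t _ => M.integrable_payment r ω t i

end Measurability

/-! ### Click counts and informational rents -/

/-- Number of clicks received by ad `i` over the `T` rounds. -/
def clickCount (M : OnlineMechanism N T V μ) (σ : S) (r : Fin T → Fin N → Value V)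
    (ω : Fin T → ClickTable N K) (i : Fin N) : ℕ :=
  ∑ t, if M.click σ r ω t i then 1 else 0

lemma utility_eq (M : OnlineMechanism N T V μ) (σ : S) (r : Fin T → Fin N → Value V)
    (ω : Fin T → ClickTable N K) (i : Fin N) (v : Value V) :
    M.utility σ r ω i v = v * M.clickCount σ r ω i - ∑ t, M.payment σ r ω t i := by
  unfold utility clickCount
  rw [Finset.sum_sub_distrib]
  push_cast
  rw [Finset.mul_sum]
  simp

/-- A truthful advertiser of value `y` is at least as well off as one of value `x` would be, up to
the value of the difference for the clicks that the latter receives. -/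
lemma IsDSIC.utility_ge {M : OnlineMechanism N T V μ} (h : M.IsDSIC K) (σ : S)
    (v : Fin N → Value V) (ω : Fin T → ClickTable N K) (i : Fin N) (x y : Value V) :
    M.utility σ (fun _ => Function.update v i x) ω i x
        + (y - x) * M.clickCount σ (fun _ => Function.update v i x) ω i
      ≤ M.utility σ (fun _ => Function.update v i y) ω i y := by
  have := h σ ω i y fun _ => Function.update v i x
  simp only [Function.update_idem] at this
  refine le_trans (le_of_eq ?_) this
  rw [utility_eq, utility_eq]
  ring

variable [IsProbabilityMeasure μ] (M : OnlineMechanism N T V μ) (lam : Fin K → ℝ) (q : Fin N → ℝ)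

/-- Expected number of clicks of ad `i` under the truthful reports `v`. -/
noncomputable def expectedClicks (v : Fin N → Value V) (i : Fin N) : ℝ :=
  expectation μ lam q fun σ ω => (M.clickCount σ (fun _ => v) ω i : ℝ)

/-- Expected number of rounds in which ad `i` is in slot `m` (counted from `0`) under the truthful
reports `v`. -/
noncomputable def occupancy (v : Fin N → Value V) (i : Fin N) (m : ℕ) : ℝ :=
  expectation μ lam q fun σ (ω : Fin T → ClickTable N K) =>
    ∑ t, if (M.run σ (fun _ => v) ω t i : ℕ) = m then 1 else 0

lemma integrable_clickCount (r : Fin T → Fin N → Value V) (ω : Fin T → ClickTable N K)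
    (i : Fin N) : Integrable (fun σ => (M.clickCount σ r ω i : ℝ)) μ := by
  unfold clickCount
  push_cast
  exact integrable_finsetSum _ fun t _ =>
    M.integrable_of_run r ω t fun θ => if clicked θ (ω t) i then 1 else 0

lemma integrable_utility (r : Fin T → Fin N → Value V) (ω : Fin T → ClickTable N K)
    (i : Fin N) (v : Value V) : Integrable (fun σ => M.utility σ r ω i v) μ := by
  simp only [utility_eq]
  exact ((M.integrable_clickCount r ω i).const_mul _).sub (M.integrable_totalPayment r ω i)

/-- Conditionally on the past, an ad is clicked with probability `Λ_m q_i`, where `m` is its slot. -/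
lemma expectedClicks_eq (v : Fin N → Value V) (i : Fin N) :
    M.expectedClicks lam q v i = q i * expectation μ lam q fun σ ω =>
      ∑ t, cumProminence lam (M.run σ (fun _ => v) ω t i) := by
  have h1 : M.expectedClicks lam q v i
      = ∑ t, expectation μ lam q fun σ (ω : Fin T → ClickTable N K) =>
        if clicked (M.run σ (fun _ => v) ω t) (ω t) i then (1 : ℝ) else 0 := by
    rw [← expectation_sum _ fun t _ ω =>
      M.integrable_of_run _ ω t fun θ => if clicked θ (ω t) i then (1 : ℝ) else 0]
    simp only [expectedClicks, clickCount, Nat.cast_sum, Nat.cast_ite, Nat.cast_one, Nat.cast_zero]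
    rfl
  rw [h1, expectation_sum _ fun t _ ω =>
    M.integrable_of_run _ ω t fun θ => cumProminence lam (θ i), Finset.mul_sum]
  refine Finset.sum_congr rfl fun t _ => ?_
  rw [← expectation_const_mul]
  unfold expectation
  congr 1
  funext σ
  rw [clickExpectation_resample t
    fun ω w => if clicked (M.run σ (fun _ => v) ω t) w i then (1 : ℝ) else 0]
  · simp only [sum_userProb_clicked]
  · intro ω w
    simp only [run_update]

variable {lam q}

lemma occupancy_le_expectedClicks (hl : ∀ l, 0 ≤ lam l ∧ lam l ≤ 1)
    (hq : ∀ i, 0 ≤ q i ∧ q i ≤ 1) (v : Fin N → Value V) (i : Fin N) (m : ℕ) :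
    q i * (cumProminence lam m * M.occupancy lam q v i m) ≤ M.expectedClicks lam q v i := by
  rw [expectedClicks_eq, occupancy, ← expectation_const_mul]
  refine mul_le_mul_of_nonneg_left (expectation_mono hl hq (fun ω => ?_) (fun ω => ?_) ?_) (hq i).1
  · exact (integrable_finsetSum _ fun t _ => M.integrable_of_run _ ω t
      fun θ => if (θ i : ℕ) = m then (1 : ℝ) else 0).const_mul _
  · exact integrable_finsetSum _ fun t _ => M.integrable_of_run _ ω t
      fun θ => cumProminence lam (θ i)
  · intro σ ω
    rw [Finset.mul_sum]
    refine Finset.sum_le_sum fun t _ => ?_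
    split_ifs with h
    · rw [h, mul_one]
    · rw [mul_zero]
      exact cumProminence_nonneg (fun l => (hl l).1) _

lemma sum_mul_expectedClicks_le (hl : ∀ l, 0 ≤ lam l ∧ lam l ≤ 1) (hq : ∀ i, 0 ≤ q i ∧ q i ≤ 1)
    {v : Fin N → Value V} {B : ℝ} (hB : ∀ θ, socialWelfare lam q θ (fun i => (v i : ℝ)) ≤ B) :
    ∑ i, (v i : ℝ) * M.expectedClicks lam q v i ≤ T * B := by
  have hint : ∀ i (ω : Fin T → ClickTable N K), Integrable (fun σ =>
      ((v i : ℝ) * q i) * ∑ t, cumProminence lam (M.run σ (fun _ => v) ω t i)) μ := fun i ω =>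
    (integrable_finsetSum _ fun t _ => M.integrable_of_run _ ω t
      fun θ => cumProminence lam (θ i)).const_mul _
  simp only [expectedClicks_eq, ← mul_assoc, ← expectation_const_mul]
  rw [← expectation_sum _ fun i _ => hint i, ← expectation_const (μ := μ) (lam := lam) (q := q)
    (T := T) ((T : ℝ) * B)]
  refine expectation_mono hl hq (fun ω => integrable_finsetSum _ fun i _ => hint i ω)
    (fun _ => integrable_const _) fun σ ω => ?_
  simp only [Finset.mul_sum]
  rw [Finset.sum_comm]
  calc _ ≤ ∑ _t : Fin T, B := by
        refine Finset.sum_le_sum fun t _ => le_trans (le_of_eq ?_) (hB (M.run σ (fun _ => v) ω t))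
        exact Finset.sum_congr rfl fun i _ => by ring
    _ = T * B := by simp

/-- The revenue is at most the value of the clicks less the informational rent of any single
advertiser `i`, who could have reported `x` all along. -/
lemma expectedRevenue_le (hl : ∀ l, 0 < lam l ∧ lam l < 1) (hq : ∀ i, 0 ≤ q i ∧ q i ≤ 1)
    (hD : M.IsDSIC K) (hI : M.IsIR K q) (v : Fin N → Value V) (i : Fin N) (x : Value V) :
    M.expectedRevenue lam q v ≤ ∑ j, (v j : ℝ) * M.expectedClicks lam q v j
      - (v i - x) * M.expectedClicks lam q (Function.update v i x) i := by
  have hU : ∀ j, expectation μ lam q (fun σ (ω : Fin T → ClickTable N K) =>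
      M.utility σ (fun _ => v) ω j (v j)) = v j * M.expectedClicks lam q v j
        - expectation μ lam q (fun σ (ω : Fin T → ClickTable N K) =>
            ∑ t, M.payment σ (fun _ => v) ω t j) := by
    intro j
    simp only [utility_eq]
    rw [expectation_sub (fun ω => (M.integrable_clickCount _ ω j).const_mul _)
      (fun ω => M.integrable_totalPayment _ ω j), expectation_const_mul]
    rfl
  have hrev : M.expectedRevenue lam q v = ∑ j, expectation μ lam q
      (fun σ (ω : Fin T → ClickTable N K) => ∑ t, M.payment σ (fun _ => v) ω t j) := by
    rw [← expectation_sum _ fun j _ ω => M.integrable_totalPayment _ ω j]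
    unfold expectedRevenue
    congr 1
    funext σ ω
    exact Finset.sum_comm
  have hi : (v i - x) * M.expectedClicks lam q (Function.update v i x) i
      ≤ expectation μ lam q (fun σ (ω : Fin T → ClickTable N K) =>
        M.utility σ (fun _ => v) ω i (v i)) := by
    have h0 := hI lam hl (Function.update v i x) i
    rw [Function.update_self] at h0
    rw [expectedClicks, ← expectation_const_mul]
    refine (le_add_of_nonneg_left h0).trans ?_
    have hint : ∀ ω : Fin T → ClickTable N K, Integrable (fun σ =>
        ((v i : ℝ) - x) * (M.clickCount σ (fun _ => Function.update v i x) ω i : ℝ)) μ :=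
      fun ω => (M.integrable_clickCount _ ω i).const_mul _
    rw [← expectation_add (fun ω => M.integrable_utility _ ω i _) hint]
    refine expectation_mono (fun l => ⟨(hl l).1.le, (hl l).2.le⟩) hq
      (fun ω => (M.integrable_utility _ ω i _).add (hint ω))
      (fun ω => M.integrable_utility _ ω i _) fun σ ω => ?_
    simpa only [Function.update_eq_self] using hD.utility_ge σ v ω i x (v i)
  have hsum : (v i - x) * M.expectedClicks lam q (Function.update v i x) i
      ≤ ∑ j, expectation μ lam q (fun σ (ω : Fin T → ClickTable N K) =>
        M.utility σ (fun _ => v) ω j (v j)) :=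
    hi.trans (Finset.single_le_sum (fun j _ => hI lam hl v j) (Finset.mem_univ i))
  simp only [hU, Finset.sum_sub_distrib] at hsum
  rw [hrev]
  linarith

/-- Where the regret is below `c` per round, an advertiser expects few clicks if it reports a value
`x` well below its own: its rent cannot exceed the welfare that VCG leaves to the advertisers. -/
lemma expectedClicks_update_le (hl : ∀ l, 0 < lam l ∧ lam l < 1) (hq : ∀ i, 0 ≤ q i ∧ q i ≤ 1)
    (hD : M.IsDSIC K) (hI : M.IsIR K q) {v : Fin N → Value V} {c B P : ℝ}
    (hR : M.regret lam q v ≤ c * T)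
    (hB : ∀ θ, socialWelfare lam q θ (fun i => (v i : ℝ)) ≤ B)
    (hP : P ≤ ∑ i, vcgPayment lam q (fun i => (v i : ℝ)) i) (i : Fin N) (x : Value V) :
    (v i - x) * M.expectedClicks lam q (Function.update v i x) i ≤ T * (B - P + c) := by
  have h1 := M.expectedRevenue_le hl hq hD hI v i x
  have h2 := M.sum_mul_expectedClicks_le (fun l => ⟨(hl l).1.le, (hl l).2.le⟩) hq hB
  have h3 : (T : ℝ) * P ≤ T * ∑ i, vcgPayment lam q (fun i => (v i : ℝ)) i := by gcongr
  unfold regret at hR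
  linarith

end OnlineMechanism

/-! ### Unobserved clicks -/

section Kinks

variable {V : ℝ}

/-- If `C₁ ≥ C₀` are subgradients of `U₁` and `U₀`, then `U₁ - U₀` is non-decreasing. -/
lemma sub_le_sub_of_subgradient {U₁ U₀ C₁ C₀ : Value V → ℝ}
    (h₁ : ∀ x y : Value V, U₁ x + (y - x) * C₁ x ≤ U₁ y)
    (h₀ : ∀ x y : Value V, U₀ x + (y - x) * C₀ x ≤ U₀ y) (hC : ∀ x, C₀ x ≤ C₁ x)
    {x y : Value V} (hxy : x ≤ y) : U₁ x - U₀ x ≤ U₁ y - U₀ y := by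
  have hd : (0 : ℝ) ≤ y - x := sub_nonneg.2 hxy
  -- Telescoping over `n` equal steps from `x` to `y` gives the claim up to an error `O(1 / n)`.
  have key : ∀ n : ℕ, 0 < n →
      (U₁ x - U₀ x) - (U₁ y - U₀ y) ≤ (((y : ℝ) - x) * (C₀ y - C₀ x)) / n := by
    intro n hn
    have hn' : (0 : ℝ) < n := by exact_mod_cast hn
    set p : ℕ → Value V := fun k =>
      Set.projIcc 0 V (x.2.1.trans x.2.2) (x + min (k / n : ℝ) 1 * (y - x)) with hp
    have hpv : ∀ k, (p k : ℝ) = x + min (k / n : ℝ) 1 * (y - x) := by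
      intro k
      have h0 : 0 ≤ min (k / n : ℝ) 1 := le_min (by positivity) zero_le_one
      have h1 : min (k / n : ℝ) 1 ≤ 1 := min_le_right _ _
      simp only [hp]
      rw [Set.projIcc_of_mem _ ⟨by nlinarith [x.2.1], by nlinarith [y.2.2]⟩]
    have hstep : ∀ k, k < n → (p (k + 1) : ℝ) - p k = (y - x) / n := by
      intro k hk
      have hk' : ((k : ℝ) + 1) ≤ n := by exact_mod_cast hk
      rw [hpv, hpv, min_eq_left ((div_le_one hn').2 (by push_cast; exact hk')),
        min_eq_left ((div_le_one hn').2 (by linarith))]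
      push_cast
      field_simp
      ring
    have hind : ∀ k, k ≤ n → (U₁ (p 0) - U₀ (p 0)) + (y - x) / n * C₀ (p 0)
        ≤ (U₁ (p k) - U₀ (p k)) + (y - x) / n * C₀ (p k) := by
      intro k
      induction k with
      | zero => intro _; exact le_rfl
      | succ k ih =>
        intro hk
        refine (ih (by omega)).trans ?_
        have e := hstep k (by omega)
        have a := h₁ (p k) (p (k + 1))
        have b := h₀ (p (k + 1)) (p k)
        rw [e] at a
        rw [← neg_sub (p (k + 1) : ℝ), e] at b
        have c : ((y : ℝ) - x) / n * C₀ (p k) ≤ (y - x) / n * C₁ (p k) :=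
          mul_le_mul_of_nonneg_left (hC _) (by positivity)
        linarith
    have hp0 : p 0 = x := Subtype.ext (by rw [hpv]; simp)
    have hpn : p n = y := Subtype.ext (by rw [hpv, div_self hn'.ne']; simp)
    have := hind n le_rfl
    rw [hp0, hpn] at this
    have e : ((y : ℝ) - x) * (C₀ y - C₀ x) / n
        = (y - x) / n * C₀ y - (y - x) / n * C₀ x := by ring
    rw [e]
    linarith
  have hlim : Filter.Tendsto (fun n : ℕ => (((y : ℝ) - x) * (C₀ y - C₀ x)) / n) Filter.atTop
      (nhds 0) := tendsto_const_div_atTop_nhds_zero_nat _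
  have := ge_of_tendsto hlim (Filter.eventually_atTop.2 ⟨1, fun n hn => key n hn⟩)
  linarith

/-- If two convex functions agree at `a` and `b` and the subgradients of one dominate those of the
other, then they coincide in between and their subgradients differ at kinks only; with integer
subgradients in `[0, T]` there are at most `T + 1` of these. -/
lemma card_le_of_subgradient_lt {U₁ U₀ : Value V → ℝ} {C₁ C₀ : Value V → ℕ}
    (h₁ : ∀ x y : Value V, U₁ x + (y - x) * C₁ x ≤ U₁ y)
    (h₀ : ∀ x y : Value V, U₀ x + (y - x) * C₀ x ≤ U₀ y) (hC : ∀ x, C₀ x ≤ C₁ x)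
    {T : ℕ} (hT : ∀ x, C₀ x ≤ T) {a b : Value V} (ha : U₁ a = U₀ a) (hb : U₁ b = U₀ b)
    {F : Finset (Value V)} (hF : ∀ x ∈ F, a ≤ x ∧ x ≤ b ∧ C₀ x < C₁ x) : F.card ≤ T + 1 := by
  have hmono : ∀ {x y : Value V}, x ≤ y → U₁ x - U₀ x ≤ U₁ y - U₀ y := fun hxy =>
    sub_le_sub_of_subgradient (C₁ := fun x => (C₁ x : ℝ)) (C₀ := fun x => (C₀ x : ℝ))
      h₁ h₀ (fun x => by exact_mod_cast hC x) hxy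
  have heq : ∀ x ∈ F, U₁ x = U₀ x := fun x hx => by
    have h1 := hmono (hF x hx).1
    have h2 := hmono (hF x hx).2.1
    linarith
  have hlt : ∀ x ∈ F, ∀ y ∈ F, x < y → C₀ x < C₀ y := by
    intro x hx y hy hxy
    have h1 := h₁ x y
    have h2 := h₀ y x
    rw [heq x hx, heq y hy] at h1
    have hd : (0 : ℝ) < y - x := sub_pos.2 hxy
    have : (C₁ x : ℝ) ≤ C₀ y := by
      by_contra! hcon
      nlinarith
    exact (hF x hx).2.2.trans_le (by exact_mod_cast this)
  have : F.card ≤ (Finset.range (T + 1)).card :=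
    Finset.card_le_card_of_injOn C₀ (fun x _ => by simpa [Nat.lt_succ_iff] using hT x)
      (StrictMonoOn.injOn (s := (F : Set (Value V))) fun x hx y hy hxy => hlt x hx y hy hxy)
  simpa using this

end Kinks

namespace OnlineMechanism

variable {N K T : ℕ} {V : ℝ} {S : Type*} [MeasurableSpace S] {μ : Measure S}

/-- The click realization that agrees with `ω` before round `t`, has no click after round `t`, and
in round `t` only the click of ad `i` in slot `m`, if `e` holds. -/
def probe (ω : Fin T → ClickTable N K) (t : Fin T) (i : Fin N) (m : Fin K) (e : Bool) :
    Fin T → ClickTable N K := fun s j l =>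
  if s < t then ω s j l else decide (s = t) && decide (j = i) && decide (l = m) && e

lemma run_probe (M : OnlineMechanism N T V μ) (σ : S) (r : Fin T → Fin N → Value V)
    (ω : Fin T → ClickTable N K) (t : Fin T) (i : Fin N) (m : Fin K) (e : Bool)
    {s : Fin T} (hs : s ≤ t) : M.run σ r (probe ω t i m e) s = M.run σ r ω s := by
  refine (M.run_congr σ r s fun s' hs' => ?_).symm
  congr 1
  funext j l
  simp [probe, hs'.trans_le hs]

lemma click_probe_of_lt (M : OnlineMechanism N T V μ) (σ : S) (r : Fin T → Fin N → Value V)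
    (ω : Fin T → ClickTable N K) (t : Fin T) (i : Fin N) (m : Fin K) (e : Bool)
    {s : Fin T} (hs : s < t) (j : Fin N) :
    M.click σ r (probe ω t i m e) s j = M.click σ r ω s j := by
  rw [click, click, run_probe _ _ _ _ _ _ _ _ hs.le]
  congr 1
  funext j l
  simp [probe, hs]

lemma click_probe_self (M : OnlineMechanism N T V μ) (σ : S) (r : Fin T → Fin N → Value V)
    (ω : Fin T → ClickTable N K) (t : Fin T) (i : Fin N) (m : Fin K) (e : Bool) (j : Fin N) :
    M.click σ r (probe ω t i m e) t j
      = (decide ((M.run σ r ω t i : ℕ) = m) && decide (j = i) && e) := by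
  rw [click, run_probe _ _ _ _ _ _ _ _ le_rfl, clicked]
  by_cases hj : j = i
  · subst hj
    split_ifs with h
    · simp [probe, Fin.ext_iff]
    · have : (M.run σ r ω t j : ℕ) ≠ m := fun h' => h (h' ▸ m.2)
      simp [this]
  · split_ifs <;> simp [probe, hj]

lemma click_probe_of_gt (M : OnlineMechanism N T V μ) (σ : S) (r : Fin T → Fin N → Value V)
    (ω : Fin T → ClickTable N K) (t : Fin T) (i : Fin N) (m : Fin K) (e : Bool)
    {s : Fin T} (hs : t < s) (j : Fin N) : M.click σ r (probe ω t i m e) s j = false := by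
  rw [click, clicked]
  split_ifs <;> simp [probe, hs.not_gt, hs.ne']

/-- A click in a slot where ad `i` is not displayed remains unnoticed. -/
lemma click_probe_eq (M : OnlineMechanism N T V μ) (σ : S) (r : Fin T → Fin N → Value V)
    (ω : Fin T → ClickTable N K) (t : Fin T) (i : Fin N) (m : Fin K)
    (h : (M.run σ r ω t i : ℕ) ≠ m) (s : Fin T) (j : Fin N) :
    M.click σ r (probe ω t i m true) s j = M.click σ r (probe ω t i m false) s j := by
  rcases lt_trichotomy s t with hs | rfl | hs
  · rw [click_probe_of_lt _ _ _ _ _ _ _ _ hs, click_probe_of_lt _ _ _ _ _ _ _ _ hs]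
  · simp [click_probe_self, h]
  · rw [click_probe_of_gt _ _ _ _ _ _ _ _ hs, click_probe_of_gt _ _ _ _ _ _ _ _ hs]

lemma utility_probe_eq (M : OnlineMechanism N T V μ) (σ : S) (r : Fin T → Fin N → Value V)
    (ω : Fin T → ClickTable N K) (t : Fin T) (i : Fin N) (m : Fin K)
    (h : (M.run σ r ω t i : ℕ) ≠ m) (v : Value V) :
    M.utility σ r (probe ω t i m true) i v = M.utility σ r (probe ω t i m false) i v := by
  have : M.click σ r (probe ω t i m true) = M.click σ r (probe ω t i m false) :=
    funext fun s => funext fun j => M.click_probe_eq σ r ω t i m h s j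
  simp only [utility, payment, this]

lemma clickCount_probe (M : OnlineMechanism N T V μ) (σ : S) (r : Fin T → Fin N → Value V)
    (ω : Fin T → ClickTable N K) (t : Fin T) (i : Fin N) (m : Fin K) :
    M.clickCount σ r (probe ω t i m true) i = M.clickCount σ r (probe ω t i m false) i
      + if (M.run σ r ω t i : ℕ) = m then 1 else 0 := by
  split_ifs with h
  · unfold clickCount
    rw [← Finset.add_sum_erase _ _ (Finset.mem_univ t), ← Finset.add_sum_erase _
      (fun s => if M.click σ r (probe ω t i m false) s i then 1 else 0) (Finset.mem_univ t)]
    have : ∀ s ∈ Finset.univ.erase t, (if M.click σ r (probe ω t i m true) s i then 1 else 0)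
        = if M.click σ r (probe ω t i m false) s i then 1 else 0 := by
      intro s hs
      rcases lt_or_gt_of_ne (Finset.ne_of_mem_erase hs) with hs | hs
      · rw [click_probe_of_lt _ _ _ _ _ _ _ _ hs, click_probe_of_lt _ _ _ _ _ _ _ _ hs]
      · rw [click_probe_of_gt _ _ _ _ _ _ _ _ hs, click_probe_of_gt _ _ _ _ _ _ _ _ hs]
    rw [Finset.sum_congr rfl this]
    simp [click_probe_self, h, add_comm]
  · simp only [clickCount, M.click_probe_eq σ r ω t i m h, add_zero]

lemma clickCount_le (M : OnlineMechanism N T V μ) (σ : S) (r : Fin T → Fin N → Value V)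
    (ω : Fin T → ClickTable N K) (i : Fin N) : M.clickCount σ r ω i ≤ T := by
  calc M.clickCount σ r ω i ≤ ∑ _t : Fin T, 1 :=
        Finset.sum_le_sum fun t _ => by split_ifs <;> simp
    _ = T := by simp

/-- Payments cannot depend on unobserved clicks.  So an ad that is not in slot `m` when it bids `a`
or `b` is there for few of the bids in between only: at all of these a click in slot `m` would
raise the slope of the utility, whose values at `a` and `b` it does not affect. -/
lemma IsDSIC.card_slot_le {M : OnlineMechanism N T V μ} (h : M.IsDSIC K) (σ : S)
    (v : Fin N → Value V) (ω : Fin T → ClickTable N K) (t : Fin T) (i : Fin N) (m : Fin K)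
    {a b : Value V}
    (ha : (M.run σ (fun _ => Function.update v i a) ω t i : ℕ) ≠ m)
    (hb : (M.run σ (fun _ => Function.update v i b) ω t i : ℕ) ≠ m)
    {F : Finset (Value V)} (hF : ∀ x ∈ F, a ≤ x ∧ x ≤ b ∧
      (M.run σ (fun _ => Function.update v i x) ω t i : ℕ) = m) : F.card ≤ T + 1 := by
  refine card_le_of_subgradient_lt (h.utility_ge σ v (probe ω t i m true) i)
    (h.utility_ge σ v (probe ω t i m false) i) (fun x => ?_) (fun x => M.clickCount_le _ _ _ _)
    (M.utility_probe_eq _ _ _ _ _ _ ha _) (M.utility_probe_eq _ _ _ _ _ _ hb _)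
    fun x hx => ⟨(hF x hx).1, (hF x hx).2.1, ?_⟩
  · rw [clickCount_probe]
    exact Nat.le_add_right _ _
  · rw [clickCount_probe, if_pos (hF x hx).2.2]
    exact Nat.lt_succ_self _

variable [IsProbabilityMeasure μ] (M : OnlineMechanism N T V μ) {lam : Fin K → ℝ} {q : Fin N → ℝ}

lemma integrable_slotCount (r : Fin T → Fin N → Value V) (ω : Fin T → ClickTable N K) (i : Fin N)
    (m : ℕ) :
    Integrable (fun σ => ∑ t, if (M.run σ r ω t i : ℕ) = m then (1 : ℝ) else 0) μ :=
  integrable_finsetSum _ fun t _ => M.integrable_of_run r ω t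
    fun θ => if (θ i : ℕ) = m then (1 : ℝ) else 0

/-- The average occupancy of a slot over many bids between `a` and `b` hardly exceeds the sum of
the occupancies at `a` and `b`. -/
lemma sum_occupancy_update_le (hl : ∀ l, 0 ≤ lam l ∧ lam l ≤ 1) (hq : ∀ i, 0 ≤ q i ∧ q i ≤ 1)
    (hD : M.IsDSIC K) (v : Fin N → Value V) (i : Fin N) (m : Fin K) {a b : Value V}
    (F : Finset (Value V)) (hF : ∀ x ∈ F, a ≤ x ∧ x ≤ b) :
    ∑ x ∈ F, M.occupancy lam q (Function.update v i x) i m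
      ≤ F.card * (M.occupancy lam q (Function.update v i a) i m
        + M.occupancy lam q (Function.update v i b) i m) + T * (T + 1) := by
  unfold occupancy
  have hi := fun x (ω : Fin T → ClickTable N K) =>
    M.integrable_slotCount (fun _ => Function.update v i x) ω i m
  rw [← expectation_sum _ fun x _ ω => hi x ω, ← expectation_add (hi a) (hi b),
    ← expectation_const_mul, ← expectation_const (μ := μ) (lam := lam) (q := q)
    (T := T) ((T : ℝ) * (T + 1)), ← expectation_add]
  rotate_left
  · exact fun ω => ((hi a ω).add (hi b ω)).const_mul _
  · exact fun ω => integrable_const _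
  refine expectation_mono hl hq (fun ω => integrable_finsetSum _ fun x _ => hi x ω)
    (fun ω => (((hi a ω).add (hi b ω)).const_mul _).add (integrable_const _)) fun σ ω => ?_
  rw [Finset.sum_comm, ← Finset.sum_add_distrib, Finset.mul_sum]
  have hT : (T : ℝ) * (T + 1) = ∑ _t : Fin T, ((T : ℝ) + 1) := by
    rw [Finset.sum_const, Finset.card_univ, Fintype.card_fin, nsmul_eq_mul]
  rw [hT, ← Finset.sum_add_distrib]
  refine Finset.sum_le_sum fun t _ => ?_
  rw [Finset.sum_boole]
  have hcard : ((F.filter fun x =>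
      (M.run σ (fun _ => Function.update v i x) ω t i : ℕ) = m).card : ℝ) ≤ F.card := by
    exact_mod_cast Finset.card_filter_le _ _
  have hT0 : (0 : ℝ) ≤ T := Nat.cast_nonneg _
  have hF0 : (0 : ℝ) ≤ F.card := Nat.cast_nonneg _
  split_ifs with ha hb hb
  · linarith
  · linarith
  · linarith
  · have := hD.card_slot_le σ v ω t i m ha hb
      (F := F.filter fun x => (M.run σ (fun _ => Function.update v i x) ω t i : ℕ) = m)
      fun x hx => ⟨(hF x (Finset.mem_filter.1 hx).1).1, (hF x (Finset.mem_filter.1 hx).1).2,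
        (Finset.mem_filter.1 hx).2⟩
    have : ((F.filter fun x =>
      (M.run σ (fun _ => Function.update v i x) ω t i : ℕ) = m).card : ℝ) ≤ T + 1 := by
      exact_mod_cast this
    linarith

/-- Every slot is filled by exactly one ad. -/
lemma sum_occupancy (v : Fin N → Value V) (m : Fin N) :
    ∑ i, M.occupancy lam q v i m = T := by
  unfold occupancy
  rw [← expectation_sum _ fun i _ ω => M.integrable_slotCount (fun _ => v) ω i m,
    ← expectation_const (μ := μ) (lam := lam) (q := q) (T := T) (T : ℝ)]
  congr 1
  funext σ ω
  rw [Finset.sum_comm]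
  have : ∀ t, (∑ i, if (M.run σ (fun _ => v) ω t i : ℕ) = m then (1 : ℝ) else 0) = 1 := by
    intro t
    rw [Finset.sum_eq_single ((M.run σ (fun _ => v) ω t).symm m) _ (by simp)]
    · simp
    · intro i _ hi
      refine if_neg fun h => hi ?_
      rw [← Fin.ext h, Equiv.symm_apply_apply]
  simp [this]

lemma occupancy_nonneg (hl : ∀ l, 0 ≤ lam l ∧ lam l ≤ 1) (hq : ∀ i, 0 ≤ q i ∧ q i ≤ 1)
    (v : Fin N → Value V) (i : Fin N) (m : ℕ) : 0 ≤ M.occupancy lam q v i m := by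
  rw [← expectation_const (μ := μ) (lam := lam) (q := q) (T := T) (0 : ℝ)]
  refine expectation_mono hl hq (fun _ => integrable_const _)
    (fun ω => M.integrable_slotCount (fun _ => v) ω i m) fun σ ω => ?_
  exact Finset.sum_nonneg fun t _ => by split_ifs <;> simp

/-- An ad cannot be in two slots at the same time. -/
lemma occupancy_add_le (hl : ∀ l, 0 ≤ lam l ∧ lam l ≤ 1) (hq : ∀ i, 0 ≤ q i ∧ q i ≤ 1)
    (v : Fin N → Value V) (i : Fin N) {m m' : ℕ} (hm : m ≠ m') :
    M.occupancy lam q v i m + M.occupancy lam q v i m' ≤ T := by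
  unfold occupancy
  have hi := fun m (ω : Fin T → ClickTable N K) => M.integrable_slotCount (fun _ => v) ω i m
  rw [← expectation_add (hi m) (hi m'),
    ← expectation_const (μ := μ) (lam := lam) (q := q) (T := T) (T : ℝ)]
  refine expectation_mono hl hq (fun ω => (hi m ω).add (hi m' ω)) (fun _ => integrable_const _)
    fun σ ω => ?_
  rw [← Finset.sum_add_distrib]
  calc _ ≤ ∑ _t : Fin T, (1 : ℝ) := by
        refine Finset.sum_le_sum fun t _ => ?_
        by_cases h : (M.run σ (fun _ => v) ω t i : ℕ) = m
        · simp [h, hm]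
        · simp only [h, if_false, zero_add]
          split_ifs <;> simp
    _ = T := by simp

/-! ### Linear regret -/

section SmallRegret

variable {N K T : ℕ} {V : ℝ} {S : Type*} [MeasurableSpace S] {μ : Measure S}
  [IsProbabilityMeasure μ] (M : OnlineMechanism N T V μ) {q : Fin N → ℝ} {a c : ℝ}

/-- When all ads are worth about `z` per observation, VCG extracts almost the whole welfare.  So a
mechanism of small regret gives an advertiser who bids `0` against such opponents hardly any
clicks, and hardly ever the second slot. -/
lemma occupancy_second_of_bid_zero_le (hK : 2 ≤ K) (hKN : K < N) (ha : 0 < a ∧ a < 1)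
    (hq : ∀ i, 0 ≤ q i ∧ q i ≤ 1) (hD : M.IsDSIC K) (hI : M.IsIR K q)
    (hR : ∀ v, M.regret (fun _ : Fin K => a) q v ≤ c * T) {z η : ℝ} (hz : 0 ≤ z) (hη : 0 ≤ η)
    {v : Fin N → Value V} (hv : ∀ i, z ≤ q i * v i ∧ q i * v i ≤ z * (1 + η)) (i : Fin N)
    {x : Value V} (hx : (x : ℝ) = 0) :
    z * a * M.occupancy (fun _ : Fin K => a) q (Function.update v i x) i 1
      ≤ T * (z * η * N + c) := by
  have hl : ∀ _ : Fin K, 0 ≤ a ∧ a ≤ 1 := fun _ => ⟨ha.1.le, ha.2.le⟩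
  set lam : Fin K → ℝ := fun _ => a with hlam
  have h1 := M.expectedClicks_update_le (lam := lam) (fun _ => ha) hq hD hI (hR v)
    (socialWelfare_le (fun l => (hl l).1) fun i => (hv i).2)
    (le_sum_vcgPayment q _ hKN (fun l => (hl l).1) fun i => (hv i).1) i x
  have h2 := M.occupancy_le_expectedClicks (lam := lam) hl hq (Function.update v i x) i 1
  have h3 := M.occupancy_nonneg (lam := lam) hl hq (Function.update v i x) i 1
  rw [cumProminence_one (by omega)] at h2
  simp only [hlam] at h1 h2 h3 ⊢
  rw [hx, sub_zero] at h1
  have hL : ∑ m : Fin N, cumProminence lam m ≤ N := by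
    calc _ ≤ ∑ _m : Fin N, (1 : ℝ) := Finset.sum_le_sum fun m _ => cumProminence_le_one hl _
      _ = N := by simp
  calc _ ≤ (q i * v i) * a * M.occupancy lam q (Function.update v i x) i 1 := by
        gcongr
        · exact ha.1.le
        · exact (hv i).1
    _ = v i * (q i * (a * M.occupancy lam q (Function.update v i x) i 1)) := by ring
    _ ≤ v i * M.expectedClicks lam q (Function.update v i x) i :=
        mul_le_mul_of_nonneg_left h2 (v i).2.1
    _ ≤ _ := h1
    _ = T * (z * η * ∑ m : Fin N, cumProminence lam m + c) := by ring
    _ ≤ T * (z * η * N + c) := by gcongr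

/-- When two ads are worth `2 z` per observation and later slots are hardly observed, VCG extracts
almost the whole welfare.  So a mechanism of small regret hardly ever gives the first slot to one
of the two if it bids substantially less. -/
lemma occupancy_first_of_underbid_le (hK : 2 ≤ K) (hKN : K < N) (ha : 0 < a ∧ a < 1)
    (hq : ∀ i, 0 ≤ q i ∧ q i ≤ 1) (hD : M.IsDSIC K) (hI : M.IsIR K q)
    (hR : ∀ v, M.regret (fun _ : Fin K => a) q v ≤ c * T) {z : ℝ} (hz : 0 ≤ z)
    {v : Fin N → Value V} {i j : Fin N} (hij : i ≠ j) (hi : q i * v i = 2 * z)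
    (hj : q j * v j = 2 * z) (hv : ∀ k, q k * v k ≤ 2 * z)
    {x : Value V} (hx : q j * x ≤ 3 / 2 * z) (hxv : x ≤ v j) :
    z / 2 * M.occupancy (fun _ : Fin K => a) q (Function.update v j x) j 0
      ≤ T * (2 * z * ((N + 1) * a) + c) := by
  have hl : ∀ _ : Fin K, 0 ≤ a ∧ a ≤ 1 := fun _ => ⟨ha.1.le, ha.2.le⟩
  set lam : Fin K → ℝ := fun _ => a with hlam
  have hB : ∀ θ, socialWelfare lam q θ (fun i => (v i : ℝ)) ≤ 2 * z * (1 + N * a) := fun θ =>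
    (socialWelfare_le (fun l => (hl l).1) hv θ).trans
      (mul_le_mul_of_nonneg_left (sum_cumProminence_le (by omega) hl) (by positivity))
  have h1 := M.expectedClicks_update_le (lam := lam) (fun _ => ha) hq hD hI (hR v) hB
    (le_sum_vcgPayment_of_pair q _ (by omega) hKN hl hij hi hj (by positivity)) j x
  have h2 := M.occupancy_le_expectedClicks (lam := lam) hl hq (Function.update v j x) j 0
  have h3 := M.occupancy_nonneg (lam := lam) hl hq (Function.update v j x) j 0
  rw [cumProminence_zero (by omega), one_mul] at h2
  have hd : (0 : ℝ) ≤ v j - x := sub_nonneg.2 hxv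
  calc _ ≤ (q j * v j - q j * x) * M.occupancy lam q (Function.update v j x) j 0 := by
        gcongr
        linarith
    _ = (v j - x) * (q j * M.occupancy lam q (Function.update v j x) j 0) := by ring
    _ ≤ (v j - x) * M.expectedClicks lam q (Function.update v j x) j :=
        mul_le_mul_of_nonneg_left h2 hd
    _ ≤ _ := h1
    _ = T * (2 * z * ((N + 1) * a) + c) := by ring

/-- Against opponents worth about `z`, an ad worth `2 z` is hardly ever in the second slot: it is
in the first slot, since its opponents are not. -/
lemma occupancy_second_of_high_le (hK : 2 ≤ K) (hKN : K < N) (ha : 0 < a ∧ a < 1)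
    (hq : ∀ i, 0 < q i ∧ q i ≤ 1) (hD : M.IsDSIC K) (hI : M.IsIR K q)
    (hR : ∀ v, M.regret (fun _ : Fin K => a) q v ≤ c * T) {z : ℝ} (hz : 0 ≤ z)
    {v : Fin N → Value V} (hv : ∀ i, q i * v i ≤ 3 / 2 * z) (hc : 0 ≤ c)
    {y : Fin N → Value V} (hy : ∀ i, q i * y i = 2 * z) (i : Fin N) :
    z / 2 * M.occupancy (fun _ : Fin K => a) q (Function.update v i (y i)) i 1
      ≤ N * (T * (2 * z * ((N + 1) * a) + c)) := by
  have hl : ∀ _ : Fin K, 0 ≤ a ∧ a ≤ 1 := fun _ => ⟨ha.1.le, ha.2.le⟩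
  have hq' : ∀ i, 0 ≤ q i ∧ q i ≤ 1 := fun i => ⟨(hq i).1.le, (hq i).2⟩
  set lam : Fin K → ℝ := fun _ => a with hlam
  set w := Function.update v i (y i) with hw
  have h1 := M.occupancy_add_le (lam := lam) hl hq' w i (m := 1) (m' := 0) (by norm_num)
  have h2 := M.sum_occupancy (lam := lam) (q := q) w ⟨0, by omega⟩
  rw [← Finset.add_sum_erase _ _ (Finset.mem_univ i)] at h2
  have h3 : ∀ j ∈ Finset.univ.erase i, z / 2 * M.occupancy lam q w j 0
      ≤ T * (2 * z * ((N + 1) * a) + c) := by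
    intro j hj
    have hji : j ≠ i := Finset.ne_of_mem_erase hj
    have hwj : w j = v j := by simp [hw, hji]
    have := M.occupancy_first_of_underbid_le hK hKN ha hq' hD hI hR hz
      (v := Function.update w j (y j)) (i := i) (j := j) (x := v j) hji.symm
      (by simp [hw, hji.symm, hy]) (by simp [hy]) (fun k => ?_) (hv j) ?_
    · rwa [Function.update_idem, ← hwj, Function.update_eq_self] at this
    · by_cases hk : k = j
      · subst hk; simp [hy]
      by_cases hk' : k = i
      · subst hk'; simp [hw, hk, hy]
      · simp only [hw, Function.update_of_ne hk, Function.update_of_ne hk']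
        linarith [hv k]
    · rw [Function.update_self]
      refine le_of_mul_le_mul_left (a := q j) (show q j * (v j : ℝ) ≤ q j * y j from ?_) (hq j).1
      linarith [hv j, hy j]
  have h4 : z / 2 * ∑ j ∈ Finset.univ.erase i, M.occupancy lam q w j 0
      ≤ N * (T * (2 * z * ((N + 1) * a) + c)) := by
    rw [Finset.mul_sum]
    have hpos : 0 ≤ T * (2 * z * ((N + 1) * a) + c) := by
      have := ha.1.le
      positivity
    refine (Finset.sum_le_card_nsmul _ _ _ h3).trans ?_
    rw [nsmul_eq_mul]
    refine mul_le_mul_of_nonneg_right ?_ hpos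
    exact_mod_cast (Finset.card_erase_le).trans (by simp)
  refine le_trans (mul_le_mul_of_nonneg_left ?_ (by positivity)) h4
  linarith

end SmallRegret

/-- Some profile of values makes the regret linear.  Otherwise no ad would fill its share of the
second slot, on average over a fine grid of profiles in which all ads are worth about `z`.
The prominence `a` is so small that the `N` bounds of order `N * a` for the occupancy of the first
slot by underbidding ads add up to a small part of `1 / N`. -/
theorem exists_regret_gt {N K T : ℕ} {V : ℝ} {S : Type*} [MeasurableSpace S] {μ : Measure S}
    [IsProbabilityMeasure μ] (M : OnlineMechanism N T V μ) {q : Fin N → ℝ} (hK : 2 ≤ K)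
    (hKN : K < N) (hV : 0 ≤ V) (hq : ∀ i, 0 < q i ∧ q i ≤ 1) (hD : M.IsDSIC K) (hI : M.IsIR K q)
    (hT : 0 < T) {a z : ℝ} (ha : a = 1 / (64 * (N : ℝ) ^ 3)) (hz : 0 < z)
    (hzV : ∀ i, 2 * z ≤ V * q i) :
    ∃ v, z * a / (16 * N) * T < M.regret (fun _ : Fin K => a) q v := by
  by_contra! hR
  have hN : (3 : ℝ) ≤ N := by exact_mod_cast (by omega : 3 ≤ N)
  have hT' : (0 : ℝ) < T := by exact_mod_cast hT
  have ha0 : 0 < a := by rw [ha]; positivity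
  have haN : a * (64 * (N : ℝ) ^ 3) = 1 := by rw [ha]; field_simp
  have ha1 : a < 1 := by
    rw [ha, div_lt_one (by positivity)]
    nlinarith [pow_le_pow_left₀ (by norm_num) hN 3]
  have hl : ∀ _ : Fin K, 0 ≤ a ∧ a ≤ 1 := fun _ => ⟨ha0.le, ha1.le⟩
  have hq' : ∀ i, 0 ≤ q i ∧ q i ≤ 1 := fun i => ⟨(hq i).1.le, (hq i).2⟩
  set lam : Fin K → ℝ := fun _ => a with hlam
  set c := z * a / (16 * N) with hc
  have hc0 : 0 < c := by positivity
  -- The relative width of the grid, small even compared to the observation probability `a` of the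
  -- second slot.
  set η := a / (16 * (N : ℝ) ^ 2) with hη
  have hη0 : 0 < η := by positivity
  have hη1 : η ≤ 1 / 2 := by
    rw [hη, div_le_iff₀ (by positivity)]
    nlinarith
  -- The bid of ad `i` whose worth per observation is `w`.
  let bid : Fin N → ℝ → Value V := fun i w => Set.projIcc 0 V hV (w / q i)
  have hbid : ∀ i w, 0 ≤ w → w ≤ 2 * z → (bid i w : ℝ) = w / q i := by
    intro i w h0 h1
    simp only [bid]
    rw [Set.projIcc_of_mem]
    exact ⟨div_nonneg h0 (hq' i).1, (div_le_iff₀ (hq i).1).2 (h1.trans (hzV i))⟩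
  have hqbid : ∀ i w, 0 ≤ w → w ≤ 2 * z → q i * bid i w = w := by
    intro i w h0 h1
    rw [hbid i w h0 h1]
    field_simp [(hq i).1.ne']
  have hpair : ∀ (v : Fin N → Value V), (∀ i, z ≤ q i * v i ∧ q i * v i ≤ z * (1 + η)) →
      ∀ i, M.occupancy lam q (Function.update v i (bid i 0)) i 1
        + M.occupancy lam q (Function.update v i (bid i (2 * z))) i 1 ≤ 3 * T / (8 * N) := by
    intro v hv i
    have h1 := M.occupancy_second_of_bid_zero_le hK hKN ⟨ha0, ha1⟩ hq' hD hI hR hz.le hη0.le hv i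
      (x := bid i 0) (by rw [hbid i 0 le_rfl (by positivity), zero_div])
    have h2 := M.occupancy_second_of_high_le hK hKN ⟨ha0, ha1⟩ hq hD hI hR hz.le
      (v := v) (fun i => (hv i).2.trans (by nlinarith)) hc0.le
      (y := fun i => bid i (2 * z)) (fun i => hqbid i _ (by positivity) le_rfl) i
    rw [← hlam] at h1 h2
    have e1 : T * (z * η * N + c) = z * a * (T / (8 * N)) := by
      rw [hη, hc]; field_simp; ring
    have e2 : N * (T * (2 * z * ((N + 1) * a) + c)) ≤ z / 2 * (T / (4 * N)) := by
      have : N * (2 * ((N + 1) * a) + a / (16 * N)) ≤ 1 / (8 * N) := by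
        rw [ha]
        field_simp
        nlinarith
      calc N * (T * (2 * z * ((N + 1) * a) + c))
          = T * z * (N * (2 * ((N + 1) * a) + a / (16 * N))) := by rw [hc]; ring
        _ ≤ T * z * (1 / (8 * N)) := by gcongr
        _ = z / 2 * (T / (4 * N)) := by field_simp; ring
    rw [e1] at h1
    have h1' := le_of_mul_le_mul_left h1 (by positivity)
    have h2' := le_of_mul_le_mul_left (h2.trans e2) (by positivity)
    refine (add_le_add h1' h2').trans (le_of_eq ?_)
    field_simp
    norm_num
  -- A grid so fine that the `T + 1` exceptional bids per round are negligible.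
  set n := 2 * N * (T + 1) with hn
  have hn' : (n : ℝ) = 2 * N * (T + 1) := by rw [hn]; push_cast; ring
  have hn0 : (0 : ℝ) < n := by rw [hn']; positivity
  let w : Fin n → ℝ := fun k => z * (1 + η * (k / n))
  have hw : ∀ k, z ≤ w k ∧ w k ≤ z * (1 + η) := by
    intro k
    have h0 : (0 : ℝ) ≤ (k : ℝ) / n := by positivity
    have h1 : (k : ℝ) / n ≤ 1 := (div_le_one hn0).2 (by exact_mod_cast k.2.le)
    constructor
    · exact le_mul_of_one_le_right hz.le (by nlinarith)
    · simp only [w]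
      gcongr
      nlinarith
  have hw' : ∀ k, 0 ≤ w k ∧ w k ≤ 2 * z := fun k =>
    ⟨hz.le.trans (hw k).1, (hw k).2.trans (by nlinarith)⟩
  have hinj : ∀ i, Function.Injective fun k => bid i (w k) := by
    intro i k l hkl
    have h : w k = w l := by
      rw [← hqbid i (w k) (hw' k).1 (hw' k).2, ← hqbid i (w l) (hw' l).1 (hw' l).2]
      exact congrArg (fun x : Value V => q i * (x : ℝ)) hkl
    simp only [w] at h
    have h' := mul_left_cancel₀ hη0.ne' (add_left_cancel (mul_left_cancel₀ hz.ne' h))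
    rw [div_left_inj' hn0.ne'] at h'
    exact Fin.ext (by exact_mod_cast h')
  let prof : (Fin N → Fin n) → Fin N → Value V := fun u i => bid i (w (u i))
  have hprof : ∀ u i k,
      prof (Function.update u i k) = Function.update (prof u) i (bid i (w k)) := by
    intro u i k
    funext j
    by_cases hj : j = i
    · subst hj; simp [prof]
    · simp [prof, hj]
  have hline : ∀ u i, ∑ k, M.occupancy lam q (prof (Function.update u i k)) i 1
      ≤ n * (3 * T / (8 * N)) + T * (T + 1) := by
    intro u i
    have hle : ∀ w₁ w₂ : ℝ, w₁ ≤ w₂ → bid i w₁ ≤ bid i w₂ := fun w₁ w₂ h =>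
      Set.monotone_projIcc hV (div_le_div_of_nonneg_right h (hq' i).1)
    have := M.sum_occupancy_update_le (lam := lam) hl hq' hD (prof u) i ⟨1, by omega⟩
      (a := bid i 0) (b := bid i (2 * z)) (Finset.univ.image fun k => bid i (w k)) (by
        intro x hx
        obtain ⟨k, -, rfl⟩ := Finset.mem_image.1 hx
        exact ⟨hle _ _ (hw' k).1, hle _ _ (hw' k).2⟩)
    rw [Finset.sum_image (fun k _ l _ h => hinj i h),
      Finset.card_image_of_injective _ (hinj i)] at this
    simp only [Finset.card_univ, Fintype.card_fin] at this
    simp only [hprof]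
    refine this.trans ?_
    gcongr
    exact hpair _ (fun j => by
      simp only [prof]
      rw [hqbid j _ (hw' _).1 (hw' _).2]
      exact hw _) i
  -- Summing the bound for lines over all `u` counts every profile of the grid `n` times.
  have hcube : ∀ i, n * ∑ u, M.occupancy lam q (prof u) i 1
      ≤ (Fintype.card (Fin N → Fin n)) * (n * (3 * T / (8 * N)) + T * (T + 1)) := by
    intro i
    have h1 := sum_sum_update_swap i
      fun (u : Fin N → Fin n) (_ : Fin n) => M.occupancy lam q (prof u) i 1
    simp only [Finset.sum_const, Finset.card_univ, Fintype.card_fin, nsmul_eq_mul] at h1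
    rw [Finset.mul_sum, ← h1]
    refine (Finset.sum_le_card_nsmul _ _ _ fun u _ => hline u i).trans (le_of_eq ?_)
    rw [nsmul_eq_mul, Finset.card_univ]
  -- In each profile the ads together fill the second slot in all `T` rounds.
  have htotal : n * (Fintype.card (Fin N → Fin n) * (T : ℝ))
      ≤ N * ((Fintype.card (Fin N → Fin n)) * (n * (3 * T / (8 * N)) + T * (T + 1))) := by
    have h1 : ∑ i, ∑ u, M.occupancy lam q (prof u) i 1
        = Fintype.card (Fin N → Fin n) * (T : ℝ) := by
      rw [Finset.sum_comm]
      have := fun u => M.sum_occupancy (lam := lam) (q := q) (prof u) ⟨1, by omega⟩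
      simp only at this
      simp [this]
    rw [← h1, Finset.mul_sum]
    refine (Finset.sum_le_card_nsmul _ _ _ fun i _ => hcube i).trans (le_of_eq ?_)
    rw [nsmul_eq_mul, Finset.card_univ, Fintype.card_fin]
  have hcard : (0 : ℝ) < Fintype.card (Fin N → Fin n) := by
    have : 0 < n := by exact_mod_cast hn0
    have : Nonempty (Fin n) := ⟨⟨0, this⟩⟩
    exact_mod_cast Fintype.card_pos
  have h1 : n * (T : ℝ) ≤ N * (n * (3 * T / (8 * N)) + T * (T + 1)) := by
    refine le_of_mul_le_mul_left (le_trans (le_of_eq ?_) (htotal.trans (le_of_eq ?_))) hcard <;>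
      ring
  have h2 : N * (n * (3 * T / (8 * N)) + T * (T + 1)) = (3 / 8 * n + N * (T + 1)) * (T : ℝ) := by
    field_simp
  rw [h2] at h1
  have h3 := le_of_mul_le_mul_right h1 hT'
  rw [hn'] at h3
  have : 0 < (N : ℝ) * (T + 1) := by positivity
  linarith

end OnlineMechanism

end SponsoredSearch

theorem mainTheorem4 (N K : ℕ) (hK : 2 ≤ K) (hKN : K < N) (V : ℝ) (hV : 0 < V)
    (q : Fin N → ℝ) (hq : ∀ i, 0 < q i ∧ q i ≤ 1) :
    ∃ c C : ℝ, 0 < c ∧ 0 < C ∧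
      ∀ (T : ℕ) (S : Type*) [MeasurableSpace S] (μ : MeasureTheory.Measure S)
        [MeasureTheory.IsProbabilityMeasure μ]
        (M : SponsoredSearch.OnlineMechanism N T V μ),
        M.IsDSIC K → M.IsIR K q →
          (∃ (lam : Fin K → ℝ) (v : Fin N → SponsoredSearch.Value V),
            (∀ l, 0 < lam l ∧ lam l < 1) ∧ c * T ≤ M.regret lam q v) ∧
          (M.IsWBB K q →
            ∀ (lam : Fin K → ℝ) (v : Fin N → SponsoredSearch.Value V),
              (∀ l, 0 < lam l ∧ lam l < 1) → M.regret lam q v ≤ C * T) := by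
  have hN : (3 : ℝ) ≤ N := by exact_mod_cast (by omega : 3 ≤ N)
  have : Nonempty (Fin N) := ⟨⟨0, by omega⟩⟩
  obtain ⟨i₀, hi₀⟩ := Finite.exists_min q
  set z := V * q i₀ / 2 with hz
  have hz0 : 0 < z := by have := (hq i₀).1; positivity
  set a := 1 / (64 * (N : ℝ) ^ 3) with ha
  have ha0 : 0 < a := by positivity
  have ha1 : a < 1 := by
    rw [ha, div_lt_one (by positivity)]
    nlinarith [pow_le_pow_left₀ (by norm_num) hN 3]
  refine ⟨z * a / (16 * N), N * (N * V), by positivity, by positivity, ?_⟩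
  intro T S _ μ _ M hD hI
  refine ⟨?_, fun hW lam v hl => ?_⟩
  · rcases Nat.eq_zero_or_pos T with rfl | hT
    · refine ⟨fun _ => a, fun _ => ⟨0, le_rfl, hV.le⟩, fun _ => ⟨ha0, ha1⟩, ?_⟩
      simp [SponsoredSearch.OnlineMechanism.regret, SponsoredSearch.OnlineMechanism.expectedRevenue,
        SponsoredSearch.OnlineMechanism.expectation, SponsoredSearch.clickExpectation]
    · obtain ⟨v, hv⟩ := M.exists_regret_gt hK hKN hV.le hq hD hI hT ha hz0 fun i => by
        rw [hz]
        nlinarith [hi₀ i]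
      exact ⟨fun _ => a, v, fun _ => ⟨ha0, ha1⟩, hv.le⟩
  · have h1 : ∑ i, SponsoredSearch.vcgPayment lam q (fun j => (v j : ℝ)) i ≤ N * (N * V) := by
      calc _ ≤ ∑ _i : Fin N, N * V := by
            refine Finset.sum_le_sum fun i _ =>
              SponsoredSearch.vcgPayment_le q _ (fun l => ⟨(hl l).1.le, (hl l).2.le⟩)
                (fun j => ⟨?_, ?_⟩) i
            · exact mul_nonneg (hq j).1.le (v j).2.1
            · exact (mul_le_of_le_one_left (v j).2.1 (hq j).2).trans (v j).2.2
        _ = N * (N * V) := by simp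
    have h2 : (T : ℝ) * ∑ i, SponsoredSearch.vcgPayment lam q (fun j => (v j : ℝ)) i
        ≤ T * (N * (N * V)) := by
      gcongr
    have h3 := hW lam hl v
    unfold SponsoredSearch.OnlineMechanism.regret
    linarith
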